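/- Let $(h_k)_{k\ge1}$, $(g_k)_{k\ge1}$, $(e_k)_{k\ge1}$, $g$, $e$ be nonnegative random variables (channel power gains) such that the $h_k$ are i.i.d., the $g_k$ have a common law, the $e_k$ have a common law, and $(h_k)_k$ is independent of $((g_k)_k,(e_k)_k,g,e)$ (symmetric assumptions). Let $P,J,\Gamma>0$, $Q\ge0$, and put $$\gamma_{\rm MAC}(K)=\max_{k\le K}\frac{h_k\min(P,\Gamma/g_k)}{1+Qe},\quad \gamma_{\rm BC}(K)=\max_{k\le K}\frac{h_k\min(J,\Gamma/g)}{1+Qe_k},\quad \gamma_{\rm PAC}(K)=\max_{k\le K}\frac{h_k\min(P,\Gamma/g_k)}{1+Qe_k}$$ (with $\Gamma/0=\infty$), and for the reference network without primary link, with transmit power $S>0$, $\gamma_0(K)=S\max_{k\le K}h_k$. Let $C_X(K)=\mathbb E[\log_2(1+\gamma_X(K))]$ for $X\in\{{\rm MAC},{\rm BC},{\rm PAC},0\}$. Call $F:\mathbb N\to\mathbb R$ a growth function of $\max_k h_k$ if $F(K)\to\infty$ and for every $\varepsilon>0$ there are $0<a$ and $b$ with $\Pr(aF(K)\le\max_{k\le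 K}h_k\le bF(K))\ge1-\varepsilon$ for all large $K$. (1) For every growth function $F$ of $\max_k h_k$ and every $S>0$, as $K\to\infty$, $$\frac{C_{\rm MAC}(K)}{\log_2F(K)}\to1,\quad \frac{C_{\rm BC}(K)}{\log_2F(K)}\to1,\quad \frac{C_{\rm PAC}(K)}{\log_2F(K)}\to1,\quad \frac{C_0(K)}{\log_2F(K)}\to1.$$ (2) Extreme value theory supplies growth functions. If the law of $h_1$ has unbounded support and $(\max_{k\le K}h_k-b_K)/a_K$, with $a_K>0$, converges in law to the Gumbel distribution $\exp(-e^{-x})$, then $F(K)=b_K$ is a growth function. If $\max_{k\le K}h_k/a_K$, with $a_K>0$, converges in law to a Fréchet distribution $\exp(-x^{-\alpha})$, $x>0$, $\alpha>0$, then $F(K)=a_K$ is one. If $h_1$ is of "type i", i.e. its distribution function $\Phi$ is differentiable for all large $x$ and $(1-\Phi(x))/\Phi'(x)\to c$ for some $c\in(0,\infty)$ as $x\to\infty$, then $F(K)=\log K$ is one. (3) Whenever the law of $h_1$ has unbounded support and $\mathbb E[\log(1+h_1)]<\infty$, the cognitive networks have the same throughput growth as the reference network: for every $S>0$, $C_{\rm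 MAC}(K)/C_0(K)\to1$, $C_{\rm BC}(K)/C_0(K)\to1$ and $C_{\rm PAC}(K)/C_0(K)\to1$ as $K\to\infty$. -/

import Mathlib

open MeasureTheory ProbabilityTheory Filter Topology

noncomputable section

namespace CognitiveRadio

variable {Ω : Type*}

/-- Largest transmit power allowed by the peak transmit power constraint `P` and by the peak
interference power constraint `p * g ≤ Γ` at the primary receiver, i.e. `min (P, Γ / g)`, where
`Γ / 0` is read as infinity. -/
def maxPower (P Γ g : ℝ) : ℝ := if g = 0 then P else min P (Γ / g)

/-- `γ_MAC(K)`: the largest achievable receiver SNR over the users `0, …, K - 1` of the C-MAC;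
`g k` is the gain from CR `k` to PR-Rx, and `e` the gain from PR-Tx to CR-BS. -/
def snrMAC (P Γ Q : ℝ) (h g : ℕ → Ω → ℝ) (e : Ω → ℝ) (K : ℕ) (ω : Ω) : ℝ :=
  ⨆ k : Fin K, h k ω * maxPower P Γ (g k ω) / (1 + Q * e ω)

/-- `γ_BC(K)`: the largest achievable receiver SNR over the users of the C-BC; `g` is the gain
from CR-BS to PR-Rx, and `e k` the gain from PR-Tx to CR `k`. -/
def snrBC (J Γ Q : ℝ) (h : ℕ → Ω → ℝ) (g : Ω → ℝ) (e : ℕ → Ω → ℝ) (K : ℕ) (ω : Ω) : ℝ :=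
  ⨆ k : Fin K, h k ω * maxPower J Γ (g ω) / (1 + Q * e k ω)

/-- `γ_PAC(K)`: the largest achievable receiver SNR over the users of the C-PAC. -/
def snrPAC (P Γ Q : ℝ) (h g e : ℕ → Ω → ℝ) (K : ℕ) (ω : Ω) : ℝ :=
  ⨆ k : Fin K, h k ω * maxPower P Γ (g k ω) / (1 + Q * e k ω)

/-- The largest receiver SNR in the reference network (no PR link) with transmit power `S`. -/
def snrRef (S : ℝ) (h : ℕ → Ω → ℝ) (K : ℕ) (ω : Ω) : ℝ :=
  ⨆ k : Fin K, h k ω * S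

/-- `max_k h_k` over the first `K` users. -/
def maxGain (h : ℕ → Ω → ℝ) (K : ℕ) (ω : Ω) : ℝ := ⨆ k : Fin K, h k ω

variable [MeasurableSpace Ω]

/-- Ergodic throughput `E[log₂ (1 + γ)]` (bits per channel use). -/
def ergodicThroughput (μ : Measure Ω) (γ : Ω → ℝ) : ℝ :=
  ∫ ω, Real.logb 2 (1 + γ ω) ∂μ

/-- The symmetric assumptions on the channel power gains: `h k`, `g k`, `e k` are the gains attached
to CR `k`; `gBS` is the gain from CR-BS to PR-Rx (C-BC) and `eBS` the one from PR-Tx to CR-BS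
(C-MAC). The `h k` are i.i.d., the `g k` have a common law, the `e k` have a common law, and the
`h k` are jointly independent of the interference channels. No independence among the interference
channels is required, so the fully independent case is included. -/
structure SymmetricFading (μ : Measure Ω) (h g e : ℕ → Ω → ℝ) (gBS eBS : Ω → ℝ) : Prop where
  measurable_h : ∀ k, Measurable (h k)
  measurable_g : ∀ k, Measurable (g k)
  measurable_e : ∀ k, Measurable (e k)
  measurable_gBS : Measurable gBS
  measurable_eBS : Measurable eBS
  nonneg_h : ∀ k ω, 0 ≤ h k ω
  nonneg_g : ∀ k ω, 0 ≤ g k ω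
  nonneg_e : ∀ k ω, 0 ≤ e k ω
  nonneg_gBS : ∀ ω, 0 ≤ gBS ω
  nonneg_eBS : ∀ ω, 0 ≤ eBS ω
  identDistrib_h : ∀ k, IdentDistrib (h k) (h 0) μ μ
  identDistrib_g : ∀ k, IdentDistrib (g k) (g 0) μ μ
  identDistrib_e : ∀ k, IdentDistrib (e k) (e 0) μ μ
  indep_h : iIndepFun h μ
  indep_interference :
    IndepFun (fun ω k => h k ω) (fun ω => (fun k => (g k ω, e k ω), gBS ω, eBS ω)) μ

/-- The law of the gain `X` has unbounded support. -/
def UnboundedGain (μ : Measure Ω) (X : Ω → ℝ) : Prop :=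
  ∀ x : ℝ, 0 < μ {ω | x < X ω}

/-- `F` is a growth function of `max_k h_k`: `F(K) → ∞` and, in probability, `max_k h_k` is of exact
order `F(K)` as `K → ∞`, that is, `max_k h_k / F(K)` is asymptotically bounded away from `0` and
from `∞` in probability. -/
def IsGrowthFunction (μ : Measure Ω) (h : ℕ → Ω → ℝ) (F : ℕ → ℝ) : Prop :=
  Tendsto F atTop atTop ∧
    ∀ ε > (0 : ℝ), ∃ a b : ℝ, 0 < a ∧
      ∀ᶠ K : ℕ in atTop,
        1 - ε ≤ μ.real {ω | a * F K ≤ maxGain h K ω ∧ maxGain h K ω ≤ b * F K}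

/-- Gumbel domain of attraction: `(max_k h_k - b K) / a K` converges in law to the Gumbel
distribution. -/
def GumbelAttraction (μ : Measure Ω) (h : ℕ → Ω → ℝ) (a b : ℕ → ℝ) : Prop :=
  (∀ K, 0 < a K) ∧ ∀ x : ℝ,
    Tendsto (fun K : ℕ => μ.real {ω | maxGain h K ω ≤ a K * x + b K}) atTop
      (𝓝 (Real.exp (-Real.exp (-x))))

/-- Fréchet domain of attraction with index `α`: `max_k h_k / a K` converges in law to the Fréchet
distribution (the gains being nonnegative, its distribution function matters on `x > 0` only). -/
def FrechetAttraction (μ : Measure Ω) (h : ℕ → Ω → ℝ) (α : ℝ) (a : ℕ → ℝ) : Prop :=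
  (∀ K, 0 < a K) ∧ ∀ x : ℝ, 0 < x →
    Tendsto (fun K : ℕ => μ.real {ω | maxGain h K ω ≤ a K * x}) atTop
      (𝓝 (Real.exp (-x ^ (-α))))

/-- Distribution of "type i" (exponential type): the distribution function `Φ` of the gain is
eventually differentiable with density `f = Φ'`, and `(1 - Φ(x)) / f(x)` tends to a positive
constant as `x → ∞` (which makes `1 - Φ` and `f` positive for all large `x`). -/
def IsTypeI (μ : Measure Ω) (X : Ω → ℝ) : Prop :=
  (∀ᶠ x : ℝ in atTop, DifferentiableAt ℝ (fun y : ℝ => μ.real {ω | X ω ≤ y}) x) ∧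
    ∃ c : ℝ, 0 < c ∧
      Tendsto (fun x : ℝ =>
        (1 - μ.real {ω | X ω ≤ x}) / deriv (fun y : ℝ => μ.real {ω | X ω ≤ y}) x) atTop (𝓝 c)

end CognitiveRadio

end

/-! Write `M_K` for `maxGain h K`. Each SNR is `max_k h_k w_k` with weights `w_k` that lie in `[0,
W]`, are independent of the gains and are uniformly tight at `0`. Such weights change `E log(1 +
M_K)` only by additive constants and factors close to `1`.

The upper bound is `h_k w_k ≤ W M_K`. For the lower bound, the index attaining the maximum depends
on the gains alone, so whatever the gains, the weight found there is at least `δ` with probability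
at least `1 - ε`. Hence the weighted expectation is at least `(1 - ε) (log δ + E log(1 + M_K))`
(`TightWeights.mul_integral_log_max_le`). Once `E log(1 + M_K) → ∞`, all ratios tend to `1`, which
gives (3).

For (1), `E log(1 + M_K)` is compared with `log F(K)`. The lower bound is immediate from `M_K ≥ a
F(K)`. Boundedness in probability alone does not control the expectation from above, but the i.i.d.
structure does: it forces `F(2K) ≤ (b / a) F(K)`, and iterating this yields geometric tails for `M_K
/ F(K)`, uniformly in `K` (`IIDGains.exists_geometric_tail`). This also yields the integrability
that (1) does not assume.

For (2), thresholds at suitable quantiles of the limit law are compared with multiples of `F(K)`;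
for type i the tail of `h_1` lies between two exponentials. -/

namespace CognitiveRadio

/-! ### The maximum of i.i.d. gains and its logarithmic moment. -/

/-- Independent, identically distributed, nonnegative channel power gains. -/
structure IIDGains {Ω : Type*} [MeasurableSpace Ω] (μ : Measure Ω) (h : ℕ → Ω → ℝ) : Prop where
  measurable : ∀ k, Measurable (h k)
  nonneg : ∀ k ω, 0 ≤ h k ω
  identDistrib : ∀ k, IdentDistrib (h k) (h 0) μ μ
  indep : iIndepFun h μ

variable {Ω : Type*} {h : ℕ → Ω → ℝ}

theorem maxGain_le_iff {K : ℕ} (hK : 0 < K) {x : ℝ} {ω : Ω} :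
    maxGain h K ω ≤ x ↔ ∀ k < K, h k ω ≤ x := by
  have : Nonempty (Fin K) := ⟨⟨0, hK⟩⟩
  rw [maxGain, ciSup_le_iff (Set.finite_range _).bddAbove]
  exact ⟨fun H k hk => H ⟨k, hk⟩, fun H k => H k k.2⟩

theorem le_maxGain {K k : ℕ} (hk : k < K) (ω : Ω) : h k ω ≤ maxGain h K ω :=
  le_ciSup (f := fun k : Fin K => h k ω) (Set.finite_range _).bddAbove ⟨k, hk⟩

theorem exists_eq_maxGain {K : ℕ} (hK : 0 < K) (ω : Ω) : ∃ k < K, h k ω = maxGain h K ω := by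
  have : Nonempty (Fin K) := ⟨⟨0, hK⟩⟩
  obtain ⟨k, hk⟩ := exists_eq_ciSup_of_finite (f := fun k : Fin K => h k ω)
  exact ⟨k, k.2, hk⟩

theorem maxGain_nonneg (h0 : ∀ k ω, 0 ≤ h k ω) (K : ℕ) (ω : Ω) : 0 ≤ maxGain h K ω :=
  Real.iSup_nonneg fun k => h0 k ω

variable [MeasurableSpace Ω] {μ : Measure Ω}

theorem measurable_maxGain (hm : ∀ k, Measurable (h k)) (K : ℕ) : Measurable (maxGain h K) :=
  Measurable.iSup fun k : Fin K => hm k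

namespace IIDGains

theorem measurable_max (H : IIDGains μ h) (K : ℕ) : Measurable (maxGain h K) :=
  measurable_maxGain H.measurable K

theorem max_nonneg (H : IIDGains μ h) (K : ℕ) (ω : Ω) : 0 ≤ maxGain h K ω :=
  maxGain_nonneg H.nonneg K ω

theorem measureReal_gain_le (H : IIDGains μ h) (k : ℕ) (x : ℝ) :
    μ.real {ω | h k ω ≤ x} = μ.real {ω | h 0 ω ≤ x} := by
  simp only [Measure.real]
  congr 1
  exact (H.identDistrib k).measure_mem_eq measurableSet_Iic

theorem measureReal_max_le (H : IIDGains μ h) {K : ℕ} (hK : 0 < K) (x : ℝ) :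
    μ.real {ω | maxGain h K ω ≤ x} = μ.real {ω | h 0 ω ≤ x} ^ K := by
  have h1 : {ω | maxGain h K ω ≤ x} = ⋂ k ∈ Finset.range K, h k ⁻¹' Set.Iic x := by
    ext ω
    simp [maxGain_le_iff hK]
  have h2 := H.indep.measure_inter_preimage_eq_mul (Finset.range K)
    (sets := fun _ => Set.Iic x) (fun _ _ => measurableSet_Iic)
  rw [h1, Measure.real, h2, ENNReal.toReal_prod]
  calc ∏ k ∈ Finset.range K, (μ (h k ⁻¹' Set.Iic x)).toReal
      = ∏ k ∈ Finset.range K, μ.real {ω | h 0 ω ≤ x} :=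
        Finset.prod_congr rfl fun k _ => H.measureReal_gain_le k x
    _ = _ := by simp

theorem integrable_log_gain (H : IIDGains μ h)
    (hint : Integrable (fun ω => Real.log (1 + h 0 ω)) μ) (k : ℕ) :
    Integrable (fun ω => Real.log (1 + h k ω)) μ :=
  ((H.identDistrib k).comp (u := fun x => Real.log (1 + x)) (by fun_prop)).integrable_iff.2 hint

theorem integrable_log_max (H : IIDGains μ h)
    (hint : Integrable (fun ω => Real.log (1 + h 0 ω)) μ) (K : ℕ) :
    Integrable (fun ω => Real.log (1 + maxGain h K ω)) μ := by
  have h1 : Integrable (fun ω => ∑ k ∈ Finset.range K, Real.log (1 + h k ω)) μ :=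
    integrable_finsetSum _ fun k _ => H.integrable_log_gain hint k
  refine h1.mono' ?_ (ae_of_all _ fun ω => ?_)
  · have := H.measurable_max K
    exact (by fun_prop : Measurable _).aestronglyMeasurable
  · have hn : ∀ k, 0 ≤ Real.log (1 + h k ω) := fun k =>
      Real.log_nonneg (by linarith [H.nonneg k ω])
    rw [Real.norm_of_nonneg (Real.log_nonneg (by linarith [H.max_nonneg K ω]))]
    -- For `K = 0` the real supremum over the empty type is `0`, so the logarithm vanishes.
    rcases Nat.eq_zero_or_pos K with rfl | hK
    · simp [maxGain]
    · obtain ⟨k, hk, hkM⟩ := exists_eq_maxGain (h := h) hK ω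
      rw [← hkM]
      exact Finset.single_le_sum (f := fun k => Real.log (1 + h k ω)) (fun k _ => hn k)
        (Finset.mem_range.2 hk)

theorem tendsto_measureReal_max_le (H : IIDGains μ h) {x : ℝ}
    (hx : μ.real {ω | h 0 ω ≤ x} < 1) :
    Tendsto (fun K => μ.real {ω | maxGain h K ω ≤ x}) atTop (𝓝 0) := by
  refine (tendsto_pow_atTop_nhds_zero_of_lt_one measureReal_nonneg hx).congr' ?_
  filter_upwards [eventually_gt_atTop 0] with K hK using (H.measureReal_max_le hK x).symm

variable [IsProbabilityMeasure μ]

theorem measureReal_gain_gt (H : IIDGains μ h) (x : ℝ) :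
    μ.real {ω | x < h 0 ω} = 1 - μ.real {ω | h 0 ω ≤ x} := by
  rw [← probReal_compl_eq_one_sub (measurableSet_le (H.measurable 0) measurable_const)]
  congr 1; ext ω; simp

theorem measureReal_max_gt (H : IIDGains μ h) (K : ℕ) (x : ℝ) :
    μ.real {ω | x < maxGain h K ω} = 1 - μ.real {ω | maxGain h K ω ≤ x} := by
  rw [← probReal_compl_eq_one_sub (measurableSet_le (H.measurable_max K) measurable_const)]
  congr 1; ext ω; simp

theorem measureReal_gain_le_lt_one (H : IIDGains μ h) (hU : UnboundedGain μ (h 0)) (x : ℝ) :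
    μ.real {ω | h 0 ω ≤ x} < 1 := by
  have h1 : 0 < μ.real {ω | x < h 0 ω} := ENNReal.toReal_pos (hU x).ne' (measure_ne_top _ _)
  linarith [H.measureReal_gain_gt x]

theorem integral_log_max_ge (H : IIDGains μ h)
    (hint : Integrable (fun ω => Real.log (1 + h 0 ω)) μ) (K : ℕ) {T : ℝ} (hT : 0 ≤ T) :
    μ.real {ω | T ≤ maxGain h K ω} * Real.log (1 + T) ≤ ∫ ω, Real.log (1 + maxGain h K ω) ∂μ := by
  have hmeas : MeasurableSet {ω | T ≤ maxGain h K ω} :=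
    measurableSet_le measurable_const (H.measurable_max K)
  calc μ.real {ω | T ≤ maxGain h K ω} * Real.log (1 + T)
      = ∫ ω, {ω | T ≤ maxGain h K ω}.indicator (fun _ => Real.log (1 + T)) ω ∂μ := by
        rw [integral_indicator_const _ hmeas, smul_eq_mul]
    _ ≤ _ := by
        refine integral_mono ((integrable_const _).indicator hmeas) (H.integrable_log_max hint K)
          fun ω => ?_
        rw [Set.indicator_apply]
        split_ifs with hω
        · exact Real.log_le_log (by linarith) (by linarith [show T ≤ maxGain h K ω from hω])
        · exact Real.log_nonneg (by linarith [H.max_nonneg K ω])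

theorem tendsto_integral_log_max (H : IIDGains μ h) (hU : UnboundedGain μ (h 0))
    (hint : Integrable (fun ω => Real.log (1 + h 0 ω)) μ) :
    Tendsto (fun K => ∫ ω, Real.log (1 + maxGain h K ω) ∂μ) atTop atTop := by
  refine tendsto_atTop.2 fun B => ?_
  -- With probability at least `1/2` the maximum reaches `T`, and then its logarithm is at least `2
  -- |B|`.
  set T := Real.exp (2 * |B|) with hTdef
  have hT : 0 < T := Real.exp_pos _
  have h1 := (H.tendsto_measureReal_max_le (H.measureReal_gain_le_lt_one hU T)).eventually_lt_const
    (show (0 : ℝ) < 1 / 2 by norm_num)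
  filter_upwards [h1] with K hK
  have h2 := H.integral_log_max_ge hint K hT.le
  have h3 : 1 / 2 ≤ μ.real {ω | T ≤ maxGain h K ω} := by
    have : μ.real {ω | T < maxGain h K ω} ≤ μ.real {ω | T ≤ maxGain h K ω} :=
      measureReal_mono fun ω (hω : T < _) => hω.le
    linarith [H.measureReal_max_gt K T]
  have h4 : 2 * |B| ≤ Real.log (1 + T) := by
    rw [Real.le_log_iff_exp_le (by linarith)]
    linarith
  have h5 : 1 / 2 * (2 * |B|) ≤ μ.real {ω | T ≤ maxGain h K ω} * Real.log (1 + T) :=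
    mul_le_mul h3 h4 (by positivity) (by linarith)
  linarith [le_abs_self B]

end IIDGains

end CognitiveRadio

/-! ### Independent tight weights do not change the logarithmic growth. -/

namespace CognitiveRadio

/-- Bounded nonnegative weights, independent of the gains and uniformly tight at `0`. -/
structure TightWeights {Ω : Type*} [MeasurableSpace Ω] (μ : Measure Ω) (h w : ℕ → Ω → ℝ) (W : ℝ) :
    Prop where
  measurable : ∀ k, Measurable (w k)
  nonneg : ∀ k ω, 0 ≤ w k ω
  le : ∀ k ω, w k ω ≤ W
  indep : IndepFun (fun ω k => h k ω) (fun ω k => w k ω) μ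
  tight : ∀ ε > (0 : ℝ), ∃ δ > (0 : ℝ), ∀ k, μ.real {ω | w k ω < δ} ≤ ε

/-- Sequences whose maximum over the first `K` terms is first attained at the index `k`. -/
def firstMax (K k : ℕ) : Set (ℕ → ℝ) := {x | (∀ j < K, x j ≤ x k) ∧ ∀ j < k, x j < x k}

theorem measurableSet_firstMax (K k : ℕ) : MeasurableSet (firstMax K k) := by
  have : firstMax K k = (⋂ j ∈ Set.Iio K, {x : ℕ → ℝ | x j ≤ x k}) ∩
      ⋂ j ∈ Set.Iio k, {x : ℕ → ℝ | x j < x k} := by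
    ext x; simp [firstMax]
  rw [this]
  refine .inter (.biInter (Set.to_countable _) fun j _ => ?_)
    (.biInter (Set.to_countable _) fun j _ => ?_)
  · exact measurableSet_le (measurable_pi_apply j) (measurable_pi_apply k)
  · exact measurableSet_lt (measurable_pi_apply j) (measurable_pi_apply k)

theorem exists_mem_firstMax {K : ℕ} (hK : 0 < K) (x : ℕ → ℝ) : ∃ k < K, x ∈ firstMax K k := by
  classical
  have hex : ∃ k, k < K ∧ ∀ j < K, x j ≤ x k := by
    obtain ⟨k, hk, hmax⟩ := (Finset.range K).exists_max_image x ⟨0, Finset.mem_range.2 hK⟩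
    exact ⟨k, Finset.mem_range.1 hk, fun j hj => hmax j (Finset.mem_range.2 hj)⟩
  refine ⟨Nat.find hex, (Nat.find_spec hex).1, (Nat.find_spec hex).2, fun j hj => ?_⟩
  have h1 := Nat.find_min hex hj
  by_contra! hle
  exact h1 ⟨hj.trans (Nat.find_spec hex).1, fun i hi => ((Nat.find_spec hex).2 i hi).trans hle⟩

/-- Choosing the first maximizer breaks ties, so the events `firstMax K k`, `k < K`, partition the
space and can be summed over without double counting. -/
theorem firstMax_index_unique {K k l : ℕ} (hk : k < K) (hl : l < K) {x : ℕ → ℝ}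
    (hxk : x ∈ firstMax K k) (hxl : x ∈ firstMax K l) : k = l := by
  rcases lt_trichotomy k l with hlt | heq | hgt
  · exact absurd (hxl.2 k hlt) (hxk.1 l hl).not_gt
  · exact heq
  · exact absurd (hxk.2 l hgt) (hxl.1 k hk).not_gt

variable {Ω : Type*} {h w : ℕ → Ω → ℝ} {W : ℝ}

theorem maxGain_mul_le (h0 : ∀ k ω, 0 ≤ h k ω) (hW : ∀ k ω, w k ω ≤ W) (hW0 : 0 ≤ W) (K : ℕ)
    (ω : Ω) : maxGain (fun k ω => h k ω * w k ω) K ω ≤ W * maxGain h K ω := by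
  rcases Nat.eq_zero_or_pos K with rfl | hK
  · simp [maxGain]
  · refine (maxGain_le_iff hK).2 fun k hk => ?_
    calc h k ω * w k ω ≤ h k ω * W := mul_le_mul_of_nonneg_left (hW k ω) (h0 k ω)
      _ ≤ W * maxGain h K ω := by
        rw [mul_comm]; exact mul_le_mul_of_nonneg_left (le_maxGain hk ω) hW0

variable [MeasurableSpace Ω] {μ : Measure Ω}

theorem log_one_add_mul_le {c x : ℝ} (hc : 0 ≤ c) (hx : 0 ≤ x) :
    Real.log (1 + c * x) ≤ Real.log (1 + c) + Real.log (1 + x) := by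
  rw [← Real.log_mul (by positivity) (by positivity)]
  exact Real.log_le_log (by positivity) (by nlinarith)

theorem log_add_log_one_add_le {c x : ℝ} (hc : 0 < c) (hc1 : c ≤ 1) (hx : 0 ≤ x) :
    Real.log c + Real.log (1 + x) ≤ Real.log (1 + c * x) := by
  rw [← Real.log_mul (by positivity) (by positivity)]
  exact Real.log_le_log (by positivity) (by nlinarith)

namespace TightWeights

theorem bound_nonneg [IsProbabilityMeasure μ] (hw : TightWeights μ h w W) : 0 ≤ W := by
  obtain ⟨ω⟩ := nonempty_of_isProbabilityMeasure μ
  exact (hw.nonneg 0 ω).trans (hw.le 0 ω)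

theorem prod_nonneg (hw : TightWeights μ h w W) (H : IIDGains μ h) (k : ℕ) (ω : Ω) :
    0 ≤ h k ω * w k ω := mul_nonneg (H.nonneg k ω) (hw.nonneg k ω)

variable [IsProbabilityMeasure μ]

theorem log_weightedMax_le (hw : TightWeights μ h w W) (H : IIDGains μ h) (K : ℕ) (ω : Ω) :
    Real.log (1 + maxGain (fun k ω => h k ω * w k ω) K ω) ≤
      Real.log (1 + W) + Real.log (1 + maxGain h K ω) := by
  refine le_trans ?_ (log_one_add_mul_le hw.bound_nonneg (H.max_nonneg K ω))
  have h1 := maxGain_mul_le H.nonneg hw.le hw.bound_nonneg K ω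
  have h2 := maxGain_nonneg (hw.prod_nonneg H) K ω
  exact Real.log_le_log (by linarith) (by linarith)

theorem integrable_log_weightedMax (hw : TightWeights μ h w W) (H : IIDGains μ h)
    (hint : Integrable (fun ω => Real.log (1 + h 0 ω)) μ) (K : ℕ) :
    Integrable (fun ω => Real.log (1 + maxGain (fun k ω => h k ω * w k ω) K ω)) μ := by
  refine ((integrable_const (Real.log (1 + W))).add (H.integrable_log_max hint K)).mono' ?_
    (ae_of_all _ fun ω => ?_)
  · have : Measurable (maxGain (fun k ω => h k ω * w k ω) K) :=
      measurable_maxGain (fun k => (H.measurable k).mul (hw.measurable k)) K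
    exact (by fun_prop : Measurable _).aestronglyMeasurable
  · rw [Real.norm_of_nonneg (Real.log_nonneg
      (by linarith [maxGain_nonneg (hw.prod_nonneg H) K ω]))]
    exact hw.log_weightedMax_le H K ω

theorem integral_log_weightedMax_le (hw : TightWeights μ h w W) (H : IIDGains μ h)
    (hint : Integrable (fun ω => Real.log (1 + h 0 ω)) μ) (K : ℕ) :
    ∫ ω, Real.log (1 + maxGain (fun k ω => h k ω * w k ω) K ω) ∂μ ≤
      Real.log (1 + W) + ∫ ω, Real.log (1 + maxGain h K ω) ∂μ := by
  calc _ ≤ ∫ ω, (Real.log (1 + W) + Real.log (1 + maxGain h K ω)) ∂μ :=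
        integral_mono (hw.integrable_log_weightedMax H hint K)
          ((integrable_const _).add (H.integrable_log_max hint K)) (hw.log_weightedMax_le H K)
    _ = _ := by
        rw [integral_add (integrable_const _) (H.integrable_log_max hint K)]; simp

/-- Split according to the first maximizer `k`, an event of the gains only. Keeping just the part
where `w k ≥ δ` costs a factor at least `1 - ε` by independence, and there the weighted maximum is
at least `δ * h k`, that is, `δ` times the maximum. -/
theorem mul_integral_log_max_le (hw : TightWeights μ h w W) (H : IIDGains μ h)
    (hint : Integrable (fun ω => Real.log (1 + h 0 ω)) μ) {K : ℕ} (hK : 0 < K) {δ ε : ℝ}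
    (hδ : 0 < δ) (hδ1 : δ ≤ 1) (htight : ∀ k, μ.real {ω | w k ω < δ} ≤ ε) :
    (1 - ε) * ∫ ω, Real.log (1 + δ * maxGain h K ω) ∂μ ≤
      ∫ ω, Real.log (1 + maxGain (fun k ω => h k ω * w k ω) K ω) ∂μ := by
  set L : (ℕ → ℝ) → ℝ := fun x => Real.log (1 + δ * ⨆ k : Fin K, x k) with hL
  have hLmeas : Measurable L := by
    have : Measurable (fun x : ℕ → ℝ => ⨆ k : Fin K, x k) :=
      Measurable.iSup fun k : Fin K => measurable_pi_apply (k : ℕ)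
    fun_prop
  set X : Ω → ℕ → ℝ := fun ω k => h k ω with hX
  have hXmeas : Measurable X := measurable_pi_lambda _ H.measurable
  have hWmeas : Measurable (fun ω k => w k ω) := measurable_pi_lambda _ hw.measurable
  have hL0 : ∀ ω, 0 ≤ L (X ω) := fun ω =>
    Real.log_nonneg (by
      have : 0 ≤ δ * maxGain h K ω := mul_nonneg hδ.le (H.max_nonneg K ω)
      change 1 ≤ 1 + δ * maxGain h K ω
      linarith)
  have hLint : Integrable (fun ω => L (X ω)) μ := by
    refine (H.integrable_log_max hint K).mono' (hLmeas.comp hXmeas).aestronglyMeasurable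
      (ae_of_all _ fun ω => ?_)
    rw [Real.norm_of_nonneg (hL0 ω)]
    have h0 := H.max_nonneg K ω
    change Real.log (1 + δ * maxGain h K ω) ≤ _
    exact Real.log_le_log (by positivity) (by nlinarith)
  set φ : ℕ → (ℕ → ℝ) → ℝ := fun k => (firstMax K k).indicator L with hφ
  have hφmeas : ∀ k, Measurable (φ k) := fun k => hLmeas.indicator (measurableSet_firstMax K k)
  have hφint : ∀ k, Integrable (fun ω => φ k (X ω)) μ := fun k =>
    hLint.indicator (hXmeas (measurableSet_firstMax K k))
  set B : ℕ → Set (ℕ → ℝ) := fun k => {y | δ ≤ y k} with hB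
  have hBmeas : ∀ k, MeasurableSet (B k) := fun k =>
    measurableSet_le measurable_const (measurable_pi_apply k)
  set ψ : ℕ → (ℕ → ℝ) → ℝ := fun k => (B k).indicator (fun _ => 1) with hψ
  have hψmeas : ∀ k, Measurable (ψ k) := fun k => measurable_const.indicator (hBmeas k)
  have hφ0 : ∀ k ω, 0 ≤ φ k (X ω) := fun k ω => by
    by_cases hmem : X ω ∈ firstMax K k <;> simp [hφ, hmem, hL0]
  -- The only use of independence between gains and weights; the weights need not be independent of
  -- each other.
  have hprod : ∀ k, ∫ ω, φ k (X ω) * ψ k (fun k => w k ω) ∂μ =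
      (∫ ω, φ k (X ω) ∂μ) * μ.real {ω | δ ≤ w k ω} := fun k => by
    rw [hw.indep.integral_fun_comp_mul_comp hXmeas.aemeasurable hWmeas.aemeasurable
      (hφmeas k).aestronglyMeasurable (hψmeas k).aestronglyMeasurable]
    congr 1
    calc ∫ ω, ψ k (fun k => w k ω) ∂μ = ∫ ω, {ω | δ ≤ w k ω}.indicator (fun _ => (1 : ℝ)) ω ∂μ :=
          rfl
      _ = _ := by
        rw [integral_indicator_const _ (measurableSet_le measurable_const (hw.measurable k))]
        simp
  have hprodint : ∀ k, Integrable (fun ω => φ k (X ω) * ψ k (fun k => w k ω)) μ := fun k => by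
    refine (hφint k).mono' (((hφmeas k).comp hXmeas).mul
      ((hψmeas k).comp hWmeas)).aestronglyMeasurable (ae_of_all _ fun ω => ?_)
    simp only [hψ, Set.indicator_apply]
    split_ifs <;> simp [hφ0, abs_of_nonneg]
  have hprob : ∀ k, 1 - ε ≤ μ.real {ω | δ ≤ w k ω} := fun k => by
    have : {ω | δ ≤ w k ω} = {ω | w k ω < δ}ᶜ := by ext ω; simp
    rw [this, probReal_compl_eq_one_sub (measurableSet_lt (hw.measurable k) measurable_const)]
    linarith [htight k]
  -- Pointwise, exactly one term of the sum over maximizers survives, whatever the coefficients `c`.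
  have hsum : ∀ ω, ∃ k < K, X ω ∈ firstMax K k ∧ ∀ c : ℕ → ℝ,
      ∑ j ∈ Finset.range K, φ j (X ω) * c j = L (X ω) * c k := fun ω => by
    obtain ⟨k, hk, hkmem⟩ := exists_mem_firstMax hK (X ω)
    refine ⟨k, hk, hkmem, fun c => ?_⟩
    rw [Finset.sum_eq_single_of_mem k (Finset.mem_range.2 hk)]
    · simp [hφ, hkmem]
    · intro j hj hjk
      have : X ω ∉ firstMax K j := fun hmem =>
        hjk (firstMax_index_unique (Finset.mem_range.1 hj) hk hmem hkmem)
      simp [hφ, this]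
  calc (1 - ε) * ∫ ω, Real.log (1 + δ * maxGain h K ω) ∂μ
      = (1 - ε) * ∑ k ∈ Finset.range K, ∫ ω, φ k (X ω) ∂μ := by
        rw [← integral_finsetSum _ fun k _ => hφint k]
        congr 1
        refine integral_congr_ae (ae_of_all _ fun ω => ?_)
        obtain ⟨k, -, -, hc⟩ := hsum ω
        have h1 := (hc fun _ => 1).symm
        simp only [mul_one] at h1
        exact h1
    _ ≤ ∑ k ∈ Finset.range K, (∫ ω, φ k (X ω) ∂μ) * μ.real {ω | δ ≤ w k ω} := by
        rw [Finset.mul_sum]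
        refine Finset.sum_le_sum fun k _ => ?_
        rw [mul_comm]
        exact mul_le_mul_of_nonneg_left (hprob k) (integral_nonneg (hφ0 k))
    _ = ∫ ω, ∑ k ∈ Finset.range K, φ k (X ω) * ψ k (fun k => w k ω) ∂μ := by
        rw [integral_finsetSum _ fun k _ => hprodint k]
        exact Finset.sum_congr rfl fun k _ => (hprod k).symm
    _ ≤ _ := by
        refine integral_mono (integrable_finsetSum _ fun k _ => hprodint k)
          (hw.integrable_log_weightedMax H hint K) fun ω => ?_
        obtain ⟨k, hk, hkmem, hc⟩ := hsum ω
        have hlog : 0 ≤ Real.log (1 + maxGain (fun k ω => h k ω * w k ω) K ω) :=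
          Real.log_nonneg (by linarith [maxGain_nonneg (hw.prod_nonneg H) K ω])
        dsimp only
        rw [hc fun k => ψ k (fun k => w k ω)]
        simp only [hψ, Set.indicator_apply]
        split_ifs with hmem
        · rw [mul_one]
          have h1 : maxGain h K ω = h k ω :=
            le_antisymm ((maxGain_le_iff hK).2 hkmem.1) (le_maxGain hk ω)
          have h2 : h k ω * w k ω ≤ maxGain (fun k ω => h k ω * w k ω) K ω :=
            le_maxGain (h := fun k ω => h k ω * w k ω) hk ω
          have h3 : δ * h k ω ≤ h k ω * w k ω := by
            rw [mul_comm]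
            exact mul_le_mul_of_nonneg_left hmem (H.nonneg k ω)
          change Real.log (1 + δ * maxGain h K ω) ≤ _
          rw [h1]
          have h4 := mul_nonneg hδ.le (H.nonneg k ω)
          exact Real.log_le_log (by linarith) (by linarith)
        · simpa using hlog

theorem integral_log_weightedMax_ge (hw : TightWeights μ h w W) (H : IIDGains μ h)
    (hint : Integrable (fun ω => Real.log (1 + h 0 ω)) μ) {ε : ℝ} (hε : 0 < ε) (hε1 : ε ≤ 1) :
    ∃ c : ℝ, ∀ K, 0 < K → (1 - ε) * (c + ∫ ω, Real.log (1 + maxGain h K ω) ∂μ) ≤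
      ∫ ω, Real.log (1 + maxGain (fun k ω => h k ω * w k ω) K ω) ∂μ := by
  obtain ⟨δ₀, hδ₀, htight⟩ := hw.tight ε hε
  set δ := min δ₀ 1 with hδdef
  have hδ : 0 < δ := lt_min hδ₀ one_pos
  have hδ1 : δ ≤ 1 := min_le_right _ _
  refine ⟨Real.log δ, fun K hK => le_trans (mul_le_mul_of_nonneg_left ?_ (by linarith))
    (hw.mul_integral_log_max_le H hint hK hδ hδ1 fun k => (measureReal_mono
      fun ω (hω : w k ω < δ) => hω.trans_le (min_le_left _ _)).trans (htight k))⟩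
  have hb : ∀ ω, Real.log δ + Real.log (1 + maxGain h K ω) ≤
      Real.log (1 + δ * maxGain h K ω) := fun ω =>
    log_add_log_one_add_le hδ hδ1 (H.max_nonneg K ω)
  have hi : Integrable (fun ω => Real.log (1 + δ * maxGain h K ω)) μ := by
    refine (H.integrable_log_max hint K).mono' ?_ (ae_of_all _ fun ω => ?_)
    · have := H.measurable_max K
      exact (by fun_prop : Measurable _).aestronglyMeasurable
    · have h0 := H.max_nonneg K ω
      rw [Real.norm_of_nonneg (Real.log_nonneg (by nlinarith))]
      exact Real.log_le_log (by positivity) (by nlinarith)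
  calc Real.log δ + ∫ ω, Real.log (1 + maxGain h K ω) ∂μ
      = ∫ ω, (Real.log δ + Real.log (1 + maxGain h K ω)) ∂μ := by
        rw [integral_add (integrable_const _) (H.integrable_log_max hint K)]; simp
    _ ≤ _ := integral_mono ((integrable_const _).add (H.integrable_log_max hint K)) hi hb

end TightWeights

/-- Squeeze criterion for `C / D → 1` when `D → ∞`: bounds up to additive constants and up to
factors arbitrarily close to `1` suffice. -/
theorem tendsto_div_one_of_bounds {C D : ℕ → ℝ} (hD : Tendsto D atTop atTop) {u : ℝ}
    (hupper : ∀ᶠ K in atTop, C K ≤ u + D K)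
    (hlower : ∀ ε : ℝ, 0 < ε → ε ≤ 1 → ∃ c : ℝ, ∀ᶠ K in atTop, (1 - ε) * (c + D K) ≤ C K) :
    Tendsto (fun K => C K / D K) atTop (𝓝 1) := by
  rw [tendsto_order]
  constructor
  · intro a ha
    have hε : 0 < min ((1 - a) / 2) 1 := lt_min (by linarith) one_pos
    set ε := min ((1 - a) / 2) 1
    have hε2 : ε ≤ (1 - a) / 2 := min_le_left _ _
    obtain ⟨c, hc⟩ := hlower ε hε (min_le_right _ _)
    have hlim : Tendsto (fun K => (1 - ε) * (c / D K + 1)) atTop (𝓝 ((1 - ε) * (0 + 1))) :=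
      ((hD.const_div_atTop c).add_const 1).const_mul _
    filter_upwards [hlim.eventually_const_lt (show a < (1 - ε) * (0 + 1) by linarith), hc,
      hD.eventually_gt_atTop 0] with K h1 h2 h3
    refine h1.trans_le ?_
    rw [le_div_iff₀ h3]
    calc _ = (1 - ε) * (c + D K) := by field_simp
      _ ≤ _ := h2
  · intro a ha
    have hlim : Tendsto (fun K => u / D K + 1) atTop (𝓝 (0 + 1)) :=
      (hD.const_div_atTop u).add_const 1
    filter_upwards [hlim.eventually_lt_const (show 0 + 1 < a by linarith), hupper,
      hD.eventually_gt_atTop 0] with K h1 h2 h3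
    refine lt_of_le_of_lt ?_ h1
    rw [div_le_iff₀ h3]
    calc _ ≤ u + D K := h2
      _ = _ := by field_simp

variable [IsProbabilityMeasure μ]

theorem TightWeights.tendsto_integral_log_div (hw : TightWeights μ h w W) (H : IIDGains μ h)
    (hint : Integrable (fun ω => Real.log (1 + h 0 ω)) μ)
    (hD : Tendsto (fun K => ∫ ω, Real.log (1 + maxGain h K ω) ∂μ) atTop atTop) :
    Tendsto (fun K => (∫ ω, Real.log (1 + maxGain (fun k ω => h k ω * w k ω) K ω) ∂μ) /
      ∫ ω, Real.log (1 + maxGain h K ω) ∂μ) atTop (𝓝 1) := by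
  refine tendsto_div_one_of_bounds hD
    (Eventually.of_forall fun K => hw.integral_log_weightedMax_le H hint K) fun ε hε hε1 => ?_
  obtain ⟨c, hc⟩ := hw.integral_log_weightedMax_ge H hint hε hε1
  exact ⟨c, (eventually_gt_atTop 0).mono hc⟩

end CognitiveRadio

/-! ### Growth functions determine the expected logarithm of the maximum. -/

namespace CognitiveRadio

variable {Ω : Type*} {h : ℕ → Ω → ℝ} [MeasurableSpace Ω] {μ : Measure Ω} [IsProbabilityMeasure μ]

/-- Otherwise `p ^ 2 ^ n ≤ (1 - 2⁻ⁿ) ^ 2 ^ n ≤ e⁻¹ < 3 / 4`. -/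
theorem one_sub_le_half_pow {p : ℝ} (hp : 0 ≤ p) (n : ℕ) (hpow : 3 / 4 ≤ p ^ 2 ^ n) :
    1 - p ≤ (1 / 2) ^ n := by
  by_contra! hlt
  have h1 : (1 - 1 / ((2 ^ n : ℕ) : ℝ)) ^ 2 ^ n ≤ Real.exp (-1) :=
    Real.one_sub_div_pow_le_exp_neg (by exact_mod_cast Nat.one_le_two_pow)
  have h2 : p ^ 2 ^ n ≤ (1 - 1 / ((2 ^ n : ℕ) : ℝ)) ^ 2 ^ n := by
    refine pow_le_pow_left₀ hp ?_ _
    push_cast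
    rw [one_div_pow] at hlt
    linarith
  have h3 : Real.exp (-1) < 3 / 4 := by
    rw [Real.exp_neg, inv_lt_comm₀ (Real.exp_pos _) (by norm_num)]
    linarith [Real.add_one_le_exp (1 : ℝ)]
  linarith

namespace IIDGains

/-- The maximum exceeds a growth function by a geometric factor with geometrically small
probability, uniformly in the number of users. -/
theorem exists_geometric_tail (H : IIDGains μ h) {F : ℕ → ℝ} (hF : IsGrowthFunction μ h F) :
    ∃ b D : ℝ, ∃ K₀ : ℕ, 0 < b ∧ 1 < D ∧ ∀ K ≥ K₀, 0 < K ∧ 0 < F K ∧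
      ∀ n : ℕ, μ.real {ω | b * F K * D ^ n < maxGain h K ω} ≤ (1 / 2) ^ n := by
  obtain ⟨a, b, ha, hev⟩ := hF.2 (1 / 4) (by norm_num)
  obtain ⟨K₀, hK₀⟩ := eventually_atTop.1
    ((hev.and (hF.1.eventually_gt_atTop 0)).and (eventually_gt_atTop 0))
  have hpos : ∀ K ≥ K₀, 0 < K := fun K hK => (hK₀ K hK).2
  have hFpos : ∀ K ≥ K₀, 0 < F K := fun K hK => (hK₀ K hK).1.2
  have hle : ∀ K ≥ K₀, 3 / 4 ≤ μ.real {ω | h 0 ω ≤ b * F K} ^ K := fun K hK => by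
    rw [← H.measureReal_max_le (hpos K hK)]
    have h1 := (hK₀ K hK).1.1
    have h2 : μ.real {ω | a * F K ≤ maxGain h K ω ∧ maxGain h K ω ≤ b * F K} ≤
        μ.real {ω | maxGain h K ω ≤ b * F K} := measureReal_mono fun ω hω => hω.2
    linarith
  have hlt : ∀ K ≥ K₀, μ.real {ω | maxGain h K ω < a * F K} ≤ 1 / 4 := fun K hK => by
    have h1 := (hK₀ K hK).1.1
    have h2 : μ.real {ω | a * F K ≤ maxGain h K ω ∧ maxGain h K ω ≤ b * F K} ≤
        μ.real {ω | maxGain h K ω < a * F K}ᶜ :=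
      measureReal_mono fun ω hω => not_lt.2 hω.1
    rw [probReal_compl_eq_one_sub (measurableSet_lt (H.measurable_max K) measurable_const)] at h2
    linarith
  -- If this failed, `M_{2K} ≤ b F(K)` would imply `M_{2K} < a F(2K)`. The former has probability at
  -- least `(3 / 4) ^ 2`, as `M_{2K}` is the maximum of two independent copies of `M_K`; the latter
  -- at most `1 / 4`.
  have hdouble : ∀ K ≥ K₀, F (2 * K) ≤ b / a * F K := fun K hK => by
    rw [div_mul_eq_mul_div, le_div_iff₀ ha]
    by_contra! hcon
    have h1 : μ.real {ω | maxGain h (2 * K) ω ≤ b * F K} ≤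
        μ.real {ω | maxGain h (2 * K) ω < a * F (2 * K)} :=
      measureReal_mono fun ω (hω : maxGain h (2 * K) ω ≤ b * F K) => hω.trans_lt (by linarith)
    rw [H.measureReal_max_le (by have := hpos K hK; omega), mul_comm 2 K, pow_mul] at h1
    have h2 := hlt (K * 2) (by omega)
    nlinarith [hle K hK]
  -- The definition of a growth function leaves the sign of `b` open; doubling and `F > 0` determine
  -- it.
  have hba : 0 < b / a := by
    have h1 := hdouble K₀ le_rfl
    exact pos_of_mul_pos_left ((hFpos (2 * K₀) (by omega)).trans_le h1) (hFpos K₀ le_rfl).le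
  have hb : 0 < b := by
    have := mul_pos hba ha
    rwa [div_mul_cancel₀ _ ha.ne'] at this
  -- The maximum with `2` ensures that the ratio exceeds `1`.
  refine ⟨b, max (b / a) 2, K₀, hb, lt_max_of_lt_right one_lt_two,
    fun K hK => ⟨hpos K hK, hFpos K hK, fun n => ?_⟩⟩
  set D := max (b / a) 2 with hD
  have hge : ∀ n : ℕ, K₀ ≤ 2 ^ n * K := fun n => hK.trans (Nat.le_mul_of_pos_left _ (by positivity))
  have hiter : ∀ n : ℕ, F (2 ^ n * K) ≤ D ^ n * F K := fun n => by
    induction n with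
    | zero => simp
    | succ n ih =>
      have h1 := hdouble _ (hge n)
      have h2 : b / a * F (2 ^ n * K) ≤ D * F (2 ^ n * K) :=
        mul_le_mul_of_nonneg_right (le_max_left _ _) (hFpos _ (hge n)).le
      have h3 : D * F (2 ^ n * K) ≤ D * (D ^ n * F K) :=
        mul_le_mul_of_nonneg_left ih (by positivity)
      rw [show 2 ^ (n + 1) * K = 2 * (2 ^ n * K) by ring]
      calc _ ≤ D * (D ^ n * F K) := h1.trans (h2.trans h3)
        _ = _ := by ring
  -- With `p = P(M_K ≤ b F(K) D ^ n)`, the power `p ^ 2 ^ n` is the probability that `M_{2^n K}`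
  -- stays below the same threshold, which is at least `b F(2^n K)`; hence it is at least `3 / 4`.
  rw [H.measureReal_max_gt, H.measureReal_max_le (hpos K hK)]
  refine one_sub_le_half_pow (by positivity) n ?_
  rw [← pow_mul, mul_comm K]
  refine (hle _ (hge n)).trans (pow_le_pow_left₀ measureReal_nonneg
    (measureReal_mono fun ω (hω : h 0 ω ≤ b * F (2 ^ n * K)) => hω.trans ?_) _)
  calc b * F (2 ^ n * K) ≤ b * (D ^ n * F K) := mul_le_mul_of_nonneg_left (hiter n) hb.le
    _ = _ := by ring

/-- On the logarithmic scale, `log(1 + M)` exceeds `log(1 + B)` by at most `log D` times the number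
of levels `B * D ^ n` below `M`; the expected number is at most `∑ 2⁻ⁿ = 2`. A lower integral is
used because integrability is deduced from this bound. -/
theorem lintegral_log_max_le_of_tail (H : IIDGains μ h) {K : ℕ} {B D : ℝ} (hB : 0 < B)
    (hD : 1 < D) (htail : ∀ n : ℕ, μ.real {ω | B * D ^ n < maxGain h K ω} ≤ (1 / 2) ^ n) :
    ∫⁻ ω, ENNReal.ofReal (Real.log (1 + maxGain h K ω)) ∂μ ≤
      ENNReal.ofReal (Real.log (1 + B) + 2 * Real.log D) := by
  have hlogD : 0 < Real.log D := Real.log_pos hD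
  have hlogB : 0 < Real.log (1 + B) := Real.log_pos (by linarith)
  set E : ℕ → Set Ω := fun n => {ω | B * D ^ n < maxGain h K ω} with hE
  have hEmeas : ∀ n, MeasurableSet (E n) := fun n =>
    measurableSet_lt measurable_const (H.measurable_max K)
  have hpt : ∀ ω, ENNReal.ofReal (Real.log (1 + maxGain h K ω)) ≤
      ENNReal.ofReal (Real.log (1 + B)) +
        ENNReal.ofReal (Real.log D) * ∑' n, (E n).indicator (fun _ => (1 : ENNReal)) ω := by
    intro ω
    have hex : ∃ n, maxGain h K ω ≤ B * D ^ n := by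
      obtain ⟨n, hn⟩ := pow_unbounded_of_one_lt (maxGain h K ω / B) hD
      exact ⟨n, by rw [div_lt_iff₀ hB] at hn; linarith⟩
    obtain ⟨m, hmle, hmin⟩ : ∃ m, maxGain h K ω ≤ B * D ^ m ∧ ∀ n < m, ω ∈ E n := by
      classical
      exact ⟨Nat.find hex, Nat.find_spec hex, fun n hn => not_le.1 (Nat.find_min hex hn)⟩
    have hsum : (m : ENNReal) ≤ ∑' n, (E n).indicator (fun _ => (1 : ENNReal)) ω := by
      refine le_trans (le_of_eq ?_) (ENNReal.sum_le_tsum (Finset.range m))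
      rw [Finset.sum_congr rfl fun n hn => Set.indicator_of_mem
        (hmin n (Finset.mem_range.1 hn)) _]
      simp
    have hlog : Real.log (1 + maxGain h K ω) ≤ Real.log (1 + B) + Real.log D * m := by
      rw [mul_comm, ← Real.log_pow, ← Real.log_mul (by positivity) (by positivity)]
      have h1 : 1 ≤ D ^ m := one_le_pow₀ hD.le
      exact Real.log_le_log (by linarith [H.max_nonneg K ω]) (by linarith)
    calc _ ≤ ENNReal.ofReal (Real.log (1 + B) + Real.log D * m) := ENNReal.ofReal_le_ofReal hlog
      _ = ENNReal.ofReal (Real.log (1 + B)) + ENNReal.ofReal (Real.log D) * m := by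
        rw [ENNReal.ofReal_add hlogB.le (by positivity), ENNReal.ofReal_mul hlogD.le,
          ENNReal.ofReal_natCast]
      _ ≤ _ := by gcongr
  have htsum : ∑' n, μ (E n) ≤ 2 := by
    have h1 : ∀ n, μ (E n) ≤ ENNReal.ofReal ((1 / 2) ^ n) := fun n => by
      rw [← ofReal_measureReal (measure_ne_top μ _)]
      exact ENNReal.ofReal_le_ofReal (htail n)
    calc ∑' n, μ (E n) ≤ ∑' n : ℕ, ENNReal.ofReal ((1 / 2) ^ n) := ENNReal.tsum_le_tsum h1
      _ = ENNReal.ofReal (∑' n : ℕ, (1 / 2) ^ n) :=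
        (ENNReal.ofReal_tsum_of_nonneg (fun n => by positivity) summable_geometric_two).symm
      _ = 2 := by rw [tsum_geometric_two]; simp
  calc ∫⁻ ω, ENNReal.ofReal (Real.log (1 + maxGain h K ω)) ∂μ
      ≤ ∫⁻ ω, (ENNReal.ofReal (Real.log (1 + B)) +
        ENNReal.ofReal (Real.log D) * ∑' n, (E n).indicator (fun _ => (1 : ENNReal)) ω) ∂μ :=
        lintegral_mono hpt
    _ = ENNReal.ofReal (Real.log (1 + B)) + ENNReal.ofReal (Real.log D) * ∑' n, μ (E n) := by
        have hmeas : ∀ n, Measurable ((E n).indicator (fun _ => (1 : ENNReal))) := fun n =>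
          measurable_const.indicator (hEmeas n)
        rw [lintegral_add_left measurable_const, lintegral_const_mul' _ _ ENNReal.ofReal_ne_top,
          lintegral_tsum fun n => (hmeas n).aemeasurable]
        simp [hEmeas]
    _ ≤ ENNReal.ofReal (Real.log (1 + B)) + ENNReal.ofReal (Real.log D) * 2 := by gcongr
    _ = _ := by
        rw [ENNReal.ofReal_add hlogB.le (by positivity), mul_comm 2,
          ENNReal.ofReal_mul hlogD.le]
        simp

theorem integrable_log_of_isGrowthFunction (H : IIDGains μ h) {F : ℕ → ℝ}
    (hF : IsGrowthFunction μ h F) : Integrable (fun ω => Real.log (1 + h 0 ω)) μ := by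
  obtain ⟨b, D, K₀, hb, hD, hK⟩ := H.exists_geometric_tail hF
  obtain ⟨hpos, hFpos, htail⟩ := hK K₀ le_rfl
  have hfin := H.lintegral_log_max_le_of_tail (mul_pos hb hFpos) hD htail
  have h0 := H.measurable 0
  refine ⟨(by fun_prop : Measurable _).aestronglyMeasurable, ?_⟩
  rw [hasFiniteIntegral_iff_ofReal
    (ae_of_all _ fun ω => Real.log_nonneg (by linarith [H.nonneg 0 ω]))]
  refine (lintegral_mono fun ω => ENNReal.ofReal_le_ofReal ?_).trans_lt
    (hfin.trans_lt ENNReal.ofReal_lt_top)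
  exact Real.log_le_log (by linarith [H.nonneg 0 ω]) (by linarith [le_maxGain (h := h) hpos ω])

/-- The geometric tail gives the upper bound up to a constant; the event `a * F K ≤ maxGain h K`
gives the lower bound up to the factor `1 - ε`. -/
theorem tendsto_integral_log_max_div (H : IIDGains μ h) {F : ℕ → ℝ}
    (hF : IsGrowthFunction μ h F) :
    Tendsto (fun K => (∫ ω, Real.log (1 + maxGain h K ω) ∂μ) / Real.log (F K)) atTop (𝓝 1) := by
  have hint := H.integrable_log_of_isGrowthFunction hF
  obtain ⟨b, D, K₀, hb, hD, hK⟩ := H.exists_geometric_tail hF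
  refine tendsto_div_one_of_bounds (u := Real.log (1 + b) + 2 * Real.log D)
    (Real.tendsto_log_atTop.comp hF.1) ?_ ?_
  · filter_upwards [eventually_ge_atTop K₀, hF.1.eventually_ge_atTop 1] with K hKK hF1
    obtain ⟨-, hFpos, htail⟩ := hK K hKK
    have hlogD : 0 < Real.log D := Real.log_pos hD
    have hlog : 0 ≤ Real.log (1 + b * F K) :=
      Real.log_nonneg (by linarith [mul_pos hb hFpos])
    have h1 : ∫ ω, Real.log (1 + maxGain h K ω) ∂μ ≤ Real.log (1 + b * F K) + 2 * Real.log D := by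
      rw [integral_eq_lintegral_of_nonneg_ae
        (ae_of_all _ fun ω => Real.log_nonneg (by linarith [H.max_nonneg K ω]))
        (H.integrable_log_max hint K).aestronglyMeasurable]
      exact ENNReal.toReal_le_of_le_ofReal (by positivity)
        (H.lintegral_log_max_le_of_tail (mul_pos hb hFpos) hD htail)
    have h2 : Real.log (1 + b * F K) ≤ Real.log (1 + b) + Real.log (F K) := by
      rw [← Real.log_mul (by positivity) (by positivity)]
      exact Real.log_le_log (by positivity) (by nlinarith)
    linarith
  · intro ε hε hε1
    obtain ⟨a, c, ha, hev⟩ := hF.2 ε hε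
    refine ⟨Real.log a, ?_⟩
    filter_upwards [hev, hF.1.eventually_gt_atTop 0] with K hKε hFpos
    have haF := mul_pos ha hFpos
    have h1 : 1 - ε ≤ μ.real {ω | a * F K ≤ maxGain h K ω} :=
      hKε.trans (measureReal_mono fun ω hω => hω.1)
    have h2 := H.integral_log_max_ge hint K haF.le
    have h3 : Real.log a + Real.log (F K) ≤ Real.log (1 + a * F K) := by
      rw [← Real.log_mul ha.ne' hFpos.ne']
      exact Real.log_le_log haF (by linarith)
    have h4 : 0 ≤ Real.log (1 + a * F K) := Real.log_nonneg (by linarith)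
    calc _ ≤ (1 - ε) * Real.log (1 + a * F K) :=
          mul_le_mul_of_nonneg_left h3 (by linarith)
      _ ≤ _ := (mul_le_mul_of_nonneg_right h1 h4).trans h2

theorem tendsto_integral_log_max_of_isGrowthFunction (H : IIDGains μ h) {F : ℕ → ℝ}
    (hF : IsGrowthFunction μ h F) :
    Tendsto (fun K => ∫ ω, Real.log (1 + maxGain h K ω) ∂μ) atTop atTop := by
  have hlog : Tendsto (fun K => Real.log (F K)) atTop atTop := Real.tendsto_log_atTop.comp hF.1
  refine ((H.tendsto_integral_log_max_div hF).pos_mul_atTop one_pos hlog).congr' ?_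
  filter_upwards [hlog.eventually_gt_atTop 0] with K hK
  exact div_mul_cancel₀ _ hK.ne'

end IIDGains

end CognitiveRadio

/-! ### Growth functions from extreme value theory. -/

namespace CognitiveRadio

variable {Ω : Type*} {h : ℕ → Ω → ℝ} [MeasurableSpace Ω] {μ : Measure Ω} [IsProbabilityMeasure μ]

theorem measureReal_le_sub_le (X : Ω → ℝ) {s s' t t' : ℝ} (hs : s' ≤ s) (ht : t ≤ t') :
    μ.real {ω | X ω ≤ t} - μ.real {ω | X ω ≤ s} ≤ μ.real {ω | s' ≤ X ω ∧ X ω ≤ t'} := by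
  have h1 : μ.real {ω | X ω ≤ t} ≤ μ.real ({ω | X ω ≤ s} ∪ {ω | s' ≤ X ω ∧ X ω ≤ t'}) := by
    refine measureReal_mono fun ω (hω : X ω ≤ t) => ?_
    rcases le_total (X ω) s with hle | hge
    · exact Or.inl hle
    · exact Or.inr ⟨hs.trans hge, hω.trans ht⟩
  linarith [measureReal_union_le (μ := μ) {ω | X ω ≤ s} {ω | s' ≤ X ω ∧ X ω ≤ t'}]

theorem isGrowthFunction_of_tendsto {F : ℕ → ℝ} (hF : Tendsto F atTop atTop)
    (hlim : ∀ ε > (0 : ℝ), ∃ a b p q : ℝ, 0 < a ∧ 1 - ε < q - p ∧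
      Tendsto (fun K => μ.real {ω | maxGain h K ω ≤ a * F K}) atTop (𝓝 p) ∧
      Tendsto (fun K => μ.real {ω | maxGain h K ω ≤ b * F K}) atTop (𝓝 q)) :
    IsGrowthFunction μ h F := by
  refine ⟨hF, fun ε hε => ?_⟩
  obtain ⟨a, b, p, q, ha, hpq, hp, hq⟩ := hlim ε hε
  refine ⟨a, b, ha, ?_⟩
  filter_upwards [(hq.sub hp).eventually_const_lt hpq] with K hK
  exact hK.le.trans (measureReal_le_sub_le _ le_rfl le_rfl)

namespace IIDGains

/-- Thresholds below which the maximum stays with non-vanishing probability leave every bounded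
set in which the gains do not live almost surely. -/
theorem eventually_lt_of_tendsto (H : IIDGains μ h) {u : ℕ → ℝ} {T p : ℝ}
    (hT : μ.real {ω | h 0 ω ≤ T} < 1) (hp : 0 < p)
    (hu : Tendsto (fun K => μ.real {ω | maxGain h K ω ≤ u K}) atTop (𝓝 p)) :
    ∀ᶠ K in atTop, T < u K := by
  filter_upwards [(H.tendsto_measureReal_max_le hT).eventually_lt hu hp] with K hK
  by_contra! hle
  exact hK.not_ge (measureReal_mono fun ω (hω : maxGain h K ω ≤ u K) => hω.trans hle)

/-- For every fixed `x` the threshold `a K * x + b K` tends to infinity, because the Gumbel limit is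
positive. Letting `x` vary makes `a K` negligible against `b K`. -/
theorem isGrowthFunction_of_gumbel (H : IIDGains μ h) {a b : ℕ → ℝ}
    (hU : UnboundedGain μ (h 0)) (hG : GumbelAttraction μ h a b) : IsGrowthFunction μ h b := by
  obtain ⟨ha, hlim⟩ := hG
  have hgt : ∀ T x : ℝ, ∀ᶠ K in atTop, T < a K * x + b K := fun T x =>
    H.eventually_lt_of_tendsto (H.measureReal_gain_le_lt_one hU T) (Real.exp_pos _) (hlim x)
  have hb : Tendsto b atTop atTop := tendsto_atTop.2 fun T => by
    filter_upwards [hgt T 0] with K hK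
    linarith
  have hquant : ∀ p : ℝ, 0 < p → p < 1 → ∃ x : ℝ, Real.exp (-Real.exp (-x)) = p := by
    intro p hp hp1
    refine ⟨-Real.log (-Real.log p), ?_⟩
    rw [neg_neg, Real.exp_log (by linarith [Real.log_neg hp hp1]), neg_neg, Real.exp_log hp]
  refine ⟨hb, fun ε hε => ?_⟩
  set η := min ε 1 / 3 with hη
  have hη0 : 0 < η := by positivity
  have hη1 : η ≤ 1 / 3 := by rw [hη]; linarith [min_le_right ε 1]
  have hηε : 3 * η ≤ ε := by rw [hη]; linarith [min_le_left ε 1]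
  obtain ⟨x, hx⟩ := hquant η hη0 (by linarith)
  obtain ⟨y, hy⟩ := hquant (1 - η) (by linarith) (by linarith)
  have hdiff := (hlim y).sub (hlim x)
  rw [hx, hy] at hdiff
  refine ⟨1 / 2, 2, by norm_num, ?_⟩
  filter_upwards [hdiff.eventually_const_lt (show 1 - ε < 1 - η - η by linarith),
    -- Positivity of the thresholds at `2 * x` and `-y` says exactly that `b K / 2 < a K * x + b K`
    -- and `a K * y + b K < 2 * b K`, whence the constants `1 / 2` and `2`.
    hgt 0 (2 * x), hgt 0 (-y)] with K hK hKx hKy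
  exact hK.le.trans (measureReal_le_sub_le _ (by linarith) (by linarith))

theorem isGrowthFunction_of_frechet (H : IIDGains μ h) {α : ℝ} {a : ℕ → ℝ} (hα : 0 < α)
    (hF : FrechetAttraction μ h α a) : IsGrowthFunction μ h a := by
  obtain ⟨ha, hlim⟩ := hF
  have hlt : ∀ x : ℝ, 0 < x → ∀ᶠ K in atTop, μ.real {ω | h 0 ω ≤ a K * x} < 1 := by
    intro x hx
    have hlt1 : Real.exp (-x ^ (-α)) < 1 := by
      rw [Real.exp_lt_one_iff]
      linarith [Real.rpow_pos_of_pos hx (-α)]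
    filter_upwards [(hlim x hx).eventually_lt_const hlt1, eventually_gt_atTop 0] with K hK hK0
    rw [H.measureReal_max_le hK0] at hK
    exact lt_of_pow_lt_pow_left₀ K zero_le_one (by rwa [one_pow])
  -- Unbounded support is automatic here. Were the gains almost surely at most `T`, then once `a K`
  -- exceeds `a K₁` the threshold `a K * (T / a K₁)` would be at least `T`, so the maximum would
  -- almost surely lie below it, whereas the Fréchet limit is less than `1`.
  have hunb : ∀ T : ℝ, μ.real {ω | h 0 ω ≤ T} < 1 := by
    intro T
    by_contra! hT
    obtain ⟨K₁, hK₁⟩ := (hlt 1 one_pos).exists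
    rw [mul_one] at hK₁
    have hTpos : 0 < T := by
      by_contra! hT0
      exact (hT.trans (measureReal_mono fun ω (hω : h 0 ω ≤ T) =>
        hω.trans (hT0.trans (ha K₁).le))).not_gt hK₁
    have h1 : ∀ᶠ K in atTop, a K₁ < a K * 1 :=
      H.eventually_lt_of_tendsto hK₁ (Real.exp_pos _) (hlim 1 one_pos)
    obtain ⟨K, hK, hKlt⟩ := (h1.and (hlt (T / a K₁) (div_pos hTpos (ha K₁)))).exists
    refine (hT.trans (measureReal_mono fun ω (hω : h 0 ω ≤ T) => hω.trans ?_)).not_gt hKlt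
    calc T = a K₁ * (T / a K₁) := by field_simp [(ha K₁).ne']
      _ ≤ a K * (T / a K₁) :=
        mul_le_mul_of_nonneg_right (by linarith) (div_pos hTpos (ha K₁)).le
  have hquant : ∀ p : ℝ, 0 < p → p < 1 → ∃ x : ℝ, 0 < x ∧ Real.exp (-x ^ (-α)) = p := by
    intro p hp hp1
    have hlog : 0 < -Real.log p := by linarith [Real.log_neg hp hp1]
    refine ⟨(-Real.log p) ^ (-α)⁻¹, Real.rpow_pos_of_pos hlog _, ?_⟩
    rw [Real.rpow_inv_rpow hlog.le (by linarith), neg_neg, Real.exp_log hp]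
  refine isGrowthFunction_of_tendsto (tendsto_atTop.2 fun T => ?_) fun ε hε => ?_
  · filter_upwards [H.eventually_lt_of_tendsto (hunb T) (Real.exp_pos _) (hlim 1 one_pos)]
      with K hK
    linarith
  set η := min ε 1 / 3 with hη
  have hη0 : 0 < η := by positivity
  have hη1 : η ≤ 1 / 3 := by rw [hη]; linarith [min_le_right ε 1]
  have hηε : 3 * η ≤ ε := by rw [hη]; linarith [min_le_left ε 1]
  obtain ⟨x, hx0, hx⟩ := hquant η hη0 (by linarith)
  obtain ⟨y, hy0, hy⟩ := hquant (1 - η) (by linarith) (by linarith)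
  refine ⟨x, y, η, 1 - η, hx0, by linarith, ?_, ?_⟩
  · simpa only [hx, mul_comm] using hlim x hx0
  · simpa only [hy, mul_comm] using hlim y hy0

end IIDGains

/-- A type i distribution has exponential upper and lower bounds on its tail. -/
theorem IsTypeI.exists_exp_bounds {X : Ω → ℝ} (hX : IsTypeI μ X) :
    ∃ c A B : ℝ, 0 < c ∧ ∀ᶠ x in atTop,
      Real.exp (A - 2 * x / c) ≤ 1 - μ.real {ω | X ω ≤ x} ∧
        1 - μ.real {ω | X ω ≤ x} ≤ Real.exp (B - x / (2 * c)) := by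
  obtain ⟨hdiff, c, hc, hlim⟩ := hX
  set Φ : ℝ → ℝ := fun y => μ.real {ω | X ω ≤ y} with hΦ
  have hΦ1 : ∀ x, Φ x ≤ 1 := fun x => measureReal_le_one
  obtain ⟨x₀, hx₀⟩ := eventually_atTop.1 ((hdiff.and
    (hlim.eventually_const_lt (show c / 2 < c by linarith))).and
    (hlim.eventually_lt_const (show c < 2 * c by linarith)))
  -- A ratio with zero numerator or denominator is `0` in Lean, so its lower bound `c / 2` rules out
  -- both.
  have hpos : ∀ x ≥ x₀, 0 < 1 - Φ x ∧ 1 / (2 * c) ≤ deriv Φ x / (1 - Φ x) ∧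
      deriv Φ x / (1 - Φ x) ≤ 2 / c := by
    intro x hx
    obtain ⟨⟨-, h1⟩, h2⟩ := hx₀ x hx
    change c / 2 < (1 - Φ x) / deriv Φ x at h1
    change (1 - Φ x) / deriv Φ x < 2 * c at h2
    have h3 : 0 < (1 - Φ x) / deriv Φ x := by linarith
    have hG : 0 < 1 - Φ x := by
      rcases (sub_nonneg.2 (hΦ1 x)).eq_or_lt with h0 | h0
      · rw [← h0, zero_div] at h3
        exact absurd h3 (lt_irrefl _)
      · exact h0
    rw [← inv_div (1 - Φ x)]
    refine ⟨hG, ?_, ?_⟩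
    · rw [one_div]
      exact inv_anti₀ h3 h2.le
    · rw [← inv_div c]
      exact inv_anti₀ (by linarith) h1.le
  have hderiv : ∀ (s : ℝ), ∀ x ≥ x₀, HasDerivAt (fun x => Real.log (1 - Φ x) + s * x)
      (-(deriv Φ x / (1 - Φ x)) + s) x := by
    intro s x hx
    have h1 := (((hx₀ x hx).1.1.hasDerivAt.const_sub 1).log (hpos x hx).1.ne').add
      ((hasDerivAt_id x).const_mul s)
    rw [mul_one, neg_div] at h1
    exact h1
  have hcont : ∀ s : ℝ, ContinuousOn (fun x => Real.log (1 - Φ x) + s * x) (Set.Ici x₀) :=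
    fun s x hx => (hderiv s x hx).continuousAt.continuousWithinAt
  have hdiffOn : ∀ s : ℝ, DifferentiableOn ℝ (fun x => Real.log (1 - Φ x) + s * x)
      (interior (Set.Ici x₀)) := fun s x hx =>
    (hderiv s x (interior_subset hx)).differentiableAt.differentiableWithinAt
  -- The logarithm of the tail has slope between `-2 / c` and `-1 / (2 * c)`; adding a line of the
  -- opposite extreme slope makes it monotone.
  have hmono : MonotoneOn (fun x => Real.log (1 - Φ x) + 2 / c * x) (Set.Ici x₀) := by
    refine monotoneOn_of_deriv_nonneg (convex_Ici x₀) (hcont _) (hdiffOn _) fun x hx => ?_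
    rw [(hderiv _ x (interior_subset hx)).deriv]
    linarith [(hpos x (interior_subset hx)).2.2]
  have hanti : AntitoneOn (fun x => Real.log (1 - Φ x) + 1 / (2 * c) * x) (Set.Ici x₀) := by
    refine antitoneOn_of_deriv_nonpos (convex_Ici x₀) (hcont _) (hdiffOn _) fun x hx => ?_
    rw [(hderiv _ x (interior_subset hx)).deriv]
    linarith [(hpos x (interior_subset hx)).2.1]
  refine ⟨c, Real.log (1 - Φ x₀) + 2 / c * x₀, Real.log (1 - Φ x₀) + 1 / (2 * c) * x₀, hc, ?_⟩
  filter_upwards [eventually_ge_atTop x₀] with x hx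
  have h1 : Real.log (1 - Φ x₀) + 2 / c * x₀ ≤ Real.log (1 - Φ x) + 2 / c * x :=
    hmono Set.self_mem_Ici hx hx
  have h2 : Real.log (1 - Φ x) + 1 / (2 * c) * x ≤ Real.log (1 - Φ x₀) + 1 / (2 * c) * x₀ :=
    hanti Set.self_mem_Ici hx hx
  constructor
  · rw [← Real.le_log_iff_exp_le (hpos x hx).1]
    rw [show 2 * x / c = 2 / c * x by ring]
    linarith
  · rw [← Real.log_le_iff_le_exp (hpos x hx).1]
    rw [show x / (2 * c) = 1 / (2 * c) * x by ring]
    linarith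

/-- The expected number of gains above `c / 4 * log K` is at least of order `K ^ (1 / 2)`, and above
`4 * c * log K` at most of order `1 / K`. So the maximum exceeds the first level and stays below the
second with probability tending to `1`. -/
theorem IIDGains.isGrowthFunction_of_isTypeI (H : IIDGains μ h) (hT : IsTypeI μ (h 0)) :
    IsGrowthFunction μ h (fun K => Real.log K) := by
  obtain ⟨c, A, B, hc, hev⟩ := hT.exists_exp_bounds
  have hlog : Tendsto (fun K : ℕ => Real.log K) atTop atTop :=
    Real.tendsto_log_atTop.comp tendsto_natCast_atTop_atTop
  have hlow : Tendsto (fun K : ℕ => μ.real {ω | maxGain h K ω ≤ c / 4 * Real.log K}) atTop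
      (𝓝 0) := by
    have hbound : Tendsto (fun K : ℕ => Real.exp (-Real.exp (A + 1 / 2 * Real.log K))) atTop
        (𝓝 0) :=
      Real.tendsto_exp_neg_atTop_nhds_zero.comp (Real.tendsto_exp_atTop.comp
        (tendsto_atTop_add_const_left _ A (hlog.const_mul_atTop (by norm_num))))
    refine squeeze_zero' (Eventually.of_forall fun K => measureReal_nonneg) ?_ hbound
    filter_upwards [(hlog.const_mul_atTop (show 0 < c / 4 by positivity)).eventually hev,
      eventually_gt_atTop 0] with K hK hK0
    have hKpos : (0 : ℝ) < K := Nat.cast_pos.2 hK0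
    rw [H.measureReal_max_le hK0]
    set φ := μ.real {ω | h 0 ω ≤ c / 4 * Real.log K} with hφ
    have h1 : φ ≤ Real.exp (-(1 - φ)) := by linarith [Real.add_one_le_exp (-(1 - φ))]
    refine (pow_le_pow_left₀ measureReal_nonneg h1 K).trans ?_
    rw [← Real.exp_nat_mul, Real.exp_le_exp]
    have h2 : Real.exp (A + 1 / 2 * Real.log K) =
        K * Real.exp (A - 2 * (c / 4 * Real.log K) / c) := by
      nth_rewrite 2 [← Real.exp_log hKpos]
      rw [← Real.exp_add]
      congr 1
      field_simp
      ring
    rw [h2]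
    linarith [mul_le_mul_of_nonneg_left hK.1 hKpos.le]
  have hupp : Tendsto (fun K : ℕ => μ.real {ω | maxGain h K ω ≤ 4 * c * Real.log K}) atTop
      (𝓝 1) := by
    have hbound : Tendsto (fun K : ℕ => 1 - Real.exp (B - Real.log K)) atTop (𝓝 (1 - 0)) :=
      (Real.tendsto_exp_atBot.comp (tendsto_atBot_add_const_left _ B
        (tendsto_neg_atTop_atBot.comp hlog))).const_sub 1
    rw [sub_zero] at hbound
    refine tendsto_of_tendsto_of_tendsto_of_le_of_le' hbound tendsto_const_nhds ?_
      (Eventually.of_forall fun K => measureReal_le_one)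
    filter_upwards [(hlog.const_mul_atTop (show 0 < 4 * c by positivity)).eventually hev,
      eventually_gt_atTop 0] with K hK hK0
    have hKpos : (0 : ℝ) < K := Nat.cast_pos.2 hK0
    rw [H.measureReal_max_le hK0]
    set φ := μ.real {ω | h 0 ω ≤ 4 * c * Real.log K} with hφ
    have hφ0 : 0 ≤ φ := measureReal_nonneg
    have h1 := one_add_mul_le_pow (show (-2 : ℝ) ≤ φ - 1 by linarith) K
    rw [add_sub_cancel] at h1
    have h2 : Real.exp (B - Real.log K) =
        K * Real.exp (B - 4 * c * Real.log K / (2 * c)) := by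
      nth_rewrite 2 [← Real.exp_log hKpos]
      rw [← Real.exp_add]
      congr 1
      field_simp
      ring
    rw [h2]
    linarith [mul_le_mul_of_nonneg_left hK.2 hKpos.le]
  exact isGrowthFunction_of_tendsto hlog fun ε hε =>
    ⟨c / 4, 4 * c, 0, 1, by positivity, by linarith, hlow, hupp⟩

end CognitiveRadio

/-! ### The cognitive networks as weighted maxima. -/

namespace CognitiveRadio

theorem measurable_maxPower (P Γ : ℝ) : Measurable (maxPower P Γ) := by
  unfold maxPower
  exact Measurable.ite (measurableSet_singleton 0) measurable_const (by fun_prop)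

theorem maxPower_nonneg {P Γ g : ℝ} (hP : 0 ≤ P) (hΓ : 0 ≤ Γ) (hg : 0 ≤ g) :
    0 ≤ maxPower P Γ g := by
  unfold maxPower
  split_ifs
  · exact hP
  · exact le_min hP (div_nonneg hΓ hg)

theorem maxPower_le (P Γ g : ℝ) : maxPower P Γ g ≤ P := by
  unfold maxPower
  split_ifs
  · exact le_rfl
  · exact min_le_left _ _

theorem min_le_maxPower {P Γ g t : ℝ} (hΓ : 0 ≤ Γ) (hg : 0 ≤ g) (hgt : g ≤ t) :
    min P (Γ / t) ≤ maxPower P Γ g := by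
  unfold maxPower
  split_ifs with h0
  · exact min_le_left _ _
  · exact min_le_min_left _ (div_le_div_of_nonneg_left hΓ (lt_of_le_of_ne hg (Ne.symm h0)) hgt)

variable {Ω : Type*} {h : ℕ → Ω → ℝ} [MeasurableSpace Ω] {μ : Measure Ω}

theorem SymmetricFading.iidGains {g e : ℕ → Ω → ℝ} {gBS eBS : Ω → ℝ}
    (hsym : SymmetricFading μ h g e gBS eBS) : IIDGains μ h :=
  ⟨hsym.measurable_h, hsym.nonneg_h, hsym.identDistrib_h, hsym.indep_h⟩

theorem tendsto_measureReal_natCast_lt [IsFiniteMeasure μ] {X : Ω → ℝ} (hX : Measurable X) :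
    Tendsto (fun n : ℕ => μ.real {ω | (n : ℝ) < X ω}) atTop (𝓝 0) := by
  have hmeas : ∀ n : ℕ, MeasurableSet {ω | (n : ℝ) < X ω} := fun n =>
    measurableSet_lt measurable_const hX
  have h1 := tendsto_measure_iInter_atTop (μ := μ) (s := fun n : ℕ => {ω | (n : ℝ) < X ω})
    (fun n => (hmeas n).nullMeasurableSet)
    (fun m n hmn ω (hω : (n : ℝ) < X ω) => (Nat.cast_le.2 hmn).trans_lt hω)
    ⟨0, measure_ne_top _ _⟩
  have h2 : ⋂ n : ℕ, {ω | (n : ℝ) < X ω} = ∅ := by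
    refine Set.eq_empty_of_forall_notMem fun ω hω => ?_
    obtain ⟨n, hn⟩ := exists_nat_ge (X ω)
    exact (Set.mem_iInter.1 hω n : (n : ℝ) < X ω).not_ge hn
  rw [h2, measure_empty] at h1
  exact (ENNReal.tendsto_toReal ENNReal.zero_ne_top).comp h1

theorem tightWeights_const [IsProbabilityMeasure μ] {S : ℝ} (hS : 0 < S) :
    TightWeights μ h (fun _ _ => S) S where
  measurable _ := measurable_const
  nonneg _ _ := hS.le
  le _ _ := le_rfl
  indep := indepFun_const_right _ _
  tight ε hε := ⟨S, hS, fun _ => by simpa using hε.le⟩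

/-- When `g k` and `e k` are both at most `n`, the weight is at least `min P (Γ / n) / (1 + Q * n)`.
The common laws allow one `n` for all users. Constant families cover `gBS` and `eBS`. -/
theorem tightWeights_maxPower_div [IsProbabilityMeasure μ] {P Γ Q : ℝ} (hP : 0 < P) (hΓ : 0 < Γ)
    (hQ : 0 ≤ Q) {g e : ℕ → Ω → ℝ} (hg : ∀ k, Measurable (g k)) (he : ∀ k, Measurable (e k))
    (hg0 : ∀ k ω, 0 ≤ g k ω) (he0 : ∀ k ω, 0 ≤ e k ω)
    (hgd : ∀ k, IdentDistrib (g k) (g 0) μ μ) (hed : ∀ k, IdentDistrib (e k) (e 0) μ μ)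
    (hind : IndepFun (fun ω k => h k ω) (fun ω k => (g k ω, e k ω)) μ) :
    TightWeights μ h (fun k ω => maxPower P Γ (g k ω) / (1 + Q * e k ω)) P where
  measurable k := ((measurable_maxPower P Γ).comp (hg k)).div
    (measurable_const.add (measurable_const.mul (he k)))
  nonneg k ω := div_nonneg (maxPower_nonneg hP.le hΓ.le (hg0 k ω))
    (by linarith [mul_nonneg hQ (he0 k ω)])
  le k ω := (div_le_self (maxPower_nonneg hP.le hΓ.le (hg0 k ω))
    (by linarith [mul_nonneg hQ (he0 k ω)])).trans (maxPower_le _ _ _)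
  indep := by
    have hm : Measurable (fun (x : ℕ → ℝ × ℝ) k => maxPower P Γ (x k).1 / (1 + Q * (x k).2)) := by
      refine measurable_pi_lambda _ fun k => ?_
      have := measurable_maxPower P Γ
      fun_prop
    exact hind.comp measurable_id hm
  tight ε hε := by
    obtain ⟨n, ⟨hgn, hen⟩, hn⟩ := ((((tendsto_measureReal_natCast_lt (μ := μ)
      (hg 0)).eventually_lt_const (half_pos hε)).and ((tendsto_measureReal_natCast_lt (μ := μ)
      (he 0)).eventually_lt_const (half_pos hε))).and (eventually_gt_atTop 0)).exists
    have hnpos : (0 : ℝ) < n := Nat.cast_pos.2 hn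
    refine ⟨min P (Γ / n) / (1 + Q * n), div_pos (lt_min hP (by positivity)) (by positivity),
      fun k => ?_⟩
    have hsub : {ω | maxPower P Γ (g k ω) / (1 + Q * e k ω) < min P (Γ / n) / (1 + Q * n)} ⊆
        {ω | (n : ℝ) < g k ω} ∪ {ω | (n : ℝ) < e k ω} := by
      intro ω hω
      by_contra hnot
      simp only [Set.mem_union, Set.mem_ofPred_eq, not_or, not_lt] at hnot
      refine (not_le.2 hω) (div_le_div₀ (maxPower_nonneg hP.le hΓ.le (hg0 k ω))
        (min_le_maxPower hΓ.le (hg0 k ω) hnot.1) (by linarith [mul_nonneg hQ (he0 k ω)])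
        (by linarith [mul_le_mul_of_nonneg_left hnot.2 hQ]))
    have h1 : μ.real {ω | (n : ℝ) < g k ω} = μ.real {ω | (n : ℝ) < g 0 ω} :=
      congrArg ENNReal.toReal ((hgd k).measure_mem_eq measurableSet_Ioi)
    have h2 : μ.real {ω | (n : ℝ) < e k ω} = μ.real {ω | (n : ℝ) < e 0 ω} :=
      congrArg ENNReal.toReal ((hed k).measure_mem_eq measurableSet_Ioi)
    linarith [measureReal_mono (μ := μ) hsub,
      measureReal_union_le (μ := μ) {ω | (n : ℝ) < g k ω} {ω | (n : ℝ) < e k ω}]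

theorem ergodicThroughput_eq (γ : Ω → ℝ) :
    ergodicThroughput μ γ = (∫ ω, Real.log (1 + γ ω) ∂μ) / Real.log 2 :=
  integral_div _ _

/-- SNR processes whose throughput grows like that of the maximum gain. -/
def GrowsLikeMaxGain (μ : Measure Ω) (h : ℕ → Ω → ℝ) (γ : ℕ → Ω → ℝ) : Prop :=
  Tendsto (fun K => ergodicThroughput μ (γ K) / ergodicThroughput μ (maxGain h K)) atTop (𝓝 1)

theorem TightWeights.growsLikeMaxGain [IsProbabilityMeasure μ] {w : ℕ → Ω → ℝ} {W : ℝ}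
    (hw : TightWeights μ h w W) (H : IIDGains μ h)
    (hint : Integrable (fun ω => Real.log (1 + h 0 ω)) μ)
    (hD : Tendsto (fun K => ∫ ω, Real.log (1 + maxGain h K ω) ∂μ) atTop atTop) :
    GrowsLikeMaxGain μ h (maxGain fun k ω => h k ω * w k ω) := by
  refine (hw.tendsto_integral_log_div H hint hD).congr fun K => ?_
  rw [ergodicThroughput_eq, ergodicThroughput_eq,
    div_div_div_cancel_right₀ (Real.log_pos one_lt_two).ne']

theorem SymmetricFading.growsLikeMaxGain [IsProbabilityMeasure μ] {g e : ℕ → Ω → ℝ}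
    {gBS eBS : Ω → ℝ} (hsym : SymmetricFading μ h g e gBS eBS) {P J Γ Q : ℝ} (hP : 0 < P)
    (hJ : 0 < J) (hΓ : 0 < Γ) (hQ : 0 ≤ Q)
    (hint : Integrable (fun ω => Real.log (1 + h 0 ω)) μ)
    (hD : Tendsto (fun K => ∫ ω, Real.log (1 + maxGain h K ω) ∂μ) atTop atTop) :
    GrowsLikeMaxGain μ h (snrMAC P Γ Q h g eBS) ∧ GrowsLikeMaxGain μ h (snrBC J Γ Q h gBS e) ∧
      GrowsLikeMaxGain μ h (snrPAC P Γ Q h g e) ∧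
      ∀ S : ℝ, 0 < S → GrowsLikeMaxGain μ h (snrRef S h) := by
  have H := hsym.iidGains
  have hMAC : Measurable (fun (x : (ℕ → ℝ × ℝ) × ℝ × ℝ) (k : ℕ) => ((x.1 k).1, x.2.2)) :=
    measurable_pi_lambda _ fun k => by fun_prop
  have hBC : Measurable (fun (x : (ℕ → ℝ × ℝ) × ℝ × ℝ) (k : ℕ) => (x.2.1, (x.1 k).2)) :=
    measurable_pi_lambda _ fun k => by fun_prop
  have hgBS : IdentDistrib gBS gBS μ μ := .refl hsym.measurable_gBS.aemeasurable
  have heBS : IdentDistrib eBS eBS μ μ := .refl hsym.measurable_eBS.aemeasurable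
  refine ⟨?_, ?_, ?_, fun S hS => (tightWeights_const hS).growsLikeMaxGain H hint hD⟩
  · have heq : snrMAC P Γ Q h g eBS = maxGain fun k ω =>
        h k ω * (maxPower P Γ (g k ω) / (1 + Q * eBS ω)) := by
      ext K ω
      simp only [snrMAC, maxGain, mul_div_assoc]
    rw [heq]
    exact (tightWeights_maxPower_div (e := fun _ => eBS) hP hΓ hQ hsym.measurable_g
      (fun _ => hsym.measurable_eBS) hsym.nonneg_g (fun _ => hsym.nonneg_eBS)
      hsym.identDistrib_g (fun _ => heBS)
      (hsym.indep_interference.comp measurable_id hMAC)).growsLikeMaxGain H hint hD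
  · have heq : snrBC J Γ Q h gBS e = maxGain fun k ω =>
        h k ω * (maxPower J Γ (gBS ω) / (1 + Q * e k ω)) := by
      ext K ω
      simp only [snrBC, maxGain, mul_div_assoc]
    rw [heq]
    exact (tightWeights_maxPower_div (g := fun _ => gBS) hJ hΓ hQ
      (fun _ => hsym.measurable_gBS) hsym.measurable_e (fun _ => hsym.nonneg_gBS) hsym.nonneg_e
      (fun _ => hgBS) hsym.identDistrib_e
      (hsym.indep_interference.comp measurable_id hBC)).growsLikeMaxGain H hint hD
  · have heq : snrPAC P Γ Q h g e = maxGain fun k ω =>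
        h k ω * (maxPower P Γ (g k ω) / (1 + Q * e k ω)) := by
      ext K ω
      simp only [snrPAC, maxGain, mul_div_assoc]
    rw [heq]
    exact (tightWeights_maxPower_div hP hΓ hQ hsym.measurable_g hsym.measurable_e
      hsym.nonneg_g hsym.nonneg_e hsym.identDistrib_g hsym.identDistrib_e
      (hsym.indep_interference.comp measurable_id measurable_fst)).growsLikeMaxGain
      H hint hD

theorem GrowsLikeMaxGain.tendsto_div_logb [IsProbabilityMeasure μ] {γ : ℕ → Ω → ℝ}
    (hγ : GrowsLikeMaxGain μ h γ) (H : IIDGains μ h) {F : ℕ → ℝ} (hF : IsGrowthFunction μ h F) :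
    Tendsto (fun K => ergodicThroughput μ (γ K) / Real.logb 2 (F K)) atTop (𝓝 1) := by
  have hlim := hγ.mul (H.tendsto_integral_log_max_div hF)
  rw [one_mul] at hlim
  refine hlim.congr' ?_
  filter_upwards
    [(H.tendsto_integral_log_max_of_isGrowthFunction hF).eventually_gt_atTop 0] with K hK
  have hlog2 := Real.log_pos one_lt_two
  rw [ergodicThroughput_eq, ergodicThroughput_eq, Real.logb,
    div_div_div_cancel_right₀ hlog2.ne', div_div_div_cancel_right₀ hlog2.ne',
    div_mul_div_cancel₀ hK.ne']

theorem GrowsLikeMaxGain.tendsto_div {γ γ' : ℕ → Ω → ℝ} (hγ : GrowsLikeMaxGain μ h γ)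
    (hγ' : GrowsLikeMaxGain μ h γ') :
    Tendsto (fun K => ergodicThroughput μ (γ K) / ergodicThroughput μ (γ' K)) atTop (𝓝 1) := by
  have hlim := hγ.div hγ' one_ne_zero
  rw [div_one] at hlim
  refine hlim.congr' ?_
  -- A ratio near `1` is nonzero, so the throughput of the maximum gain, its denominator, is nonzero
  -- and cancels.
  filter_upwards [hγ'.eventually_ne one_ne_zero] with K hK
  exact div_div_div_cancel_right₀ (fun h0 => hK (by rw [h0, div_zero])) _ _

end CognitiveRadio

open CognitiveRadio in
theorem corollary3p1 {Ω : Type*} [MeasurableSpace Ω] (μ : Measure Ω) [IsProbabilityMeasure μ]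
    (h g e : ℕ → Ω → ℝ) (gBS eBS : Ω → ℝ)
    (hsym : SymmetricFading μ h g e gBS eBS)
    (P J Γ Q : ℝ) (hP : 0 < P) (hJ : 0 < J) (hΓ : 0 < Γ) (hQ : 0 ≤ Q) :
    -- throughput growth relative to every growth function of the maximum gain
    (∀ F : ℕ → ℝ, IsGrowthFunction μ h F →
      Tendsto (fun K => ergodicThroughput μ (snrMAC P Γ Q h g eBS K) / Real.logb 2 (F K))
          atTop (𝓝 1) ∧
        Tendsto (fun K => ergodicThroughput μ (snrBC J Γ Q h gBS e K) / Real.logb 2 (F K))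
          atTop (𝓝 1) ∧
        Tendsto (fun K => ergodicThroughput μ (snrPAC P Γ Q h g e K) / Real.logb 2 (F K))
          atTop (𝓝 1) ∧
        ∀ S : ℝ, 0 < S →
          Tendsto (fun K => ergodicThroughput μ (snrRef S h K) / Real.logb 2 (F K))
            atTop (𝓝 1)) ∧
    -- extreme value theory provides growth functions
    (∀ a b : ℕ → ℝ, UnboundedGain μ (h 0) → GumbelAttraction μ h a b →
      IsGrowthFunction μ h b) ∧
    (∀ (α : ℝ) (a : ℕ → ℝ), 0 < α → FrechetAttraction μ h α a → IsGrowthFunction μ h a) ∧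
    (IsTypeI μ (h 0) → IsGrowthFunction μ h (fun K => Real.log K)) ∧
    -- same growth as the reference network, for every unbounded fading law
    (UnboundedGain μ (h 0) → Integrable (fun ω => Real.log (1 + h 0 ω)) μ →
      ∀ S : ℝ, 0 < S →
        Tendsto (fun K => ergodicThroughput μ (snrMAC P Γ Q h g eBS K) /
            ergodicThroughput μ (snrRef S h K)) atTop (𝓝 1) ∧
          Tendsto (fun K => ergodicThroughput μ (snrBC J Γ Q h gBS e K) /
            ergodicThroughput μ (snrRef S h K)) atTop (𝓝 1) ∧
          Tendsto (fun K => ergodicThroughput μ (snrPAC P Γ Q h g e K) /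
            ergodicThroughput μ (snrRef S h K)) atTop (𝓝 1)) := by
  have H := hsym.iidGains
  refine ⟨fun F hF => ?_, fun a b => H.isGrowthFunction_of_gumbel,
    fun α a => H.isGrowthFunction_of_frechet, H.isGrowthFunction_of_isTypeI,
    fun hU hint S hS => ?_⟩
  · obtain ⟨hMAC, hBC, hPAC, hRef⟩ := hsym.growsLikeMaxGain hP hJ hΓ hQ
      (H.integrable_log_of_isGrowthFunction hF) (H.tendsto_integral_log_max_of_isGrowthFunction hF)
    exact ⟨hMAC.tendsto_div_logb H hF, hBC.tendsto_div_logb H hF, hPAC.tendsto_div_logb H hF,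
      fun S hS => (hRef S hS).tendsto_div_logb H hF⟩
  · obtain ⟨hMAC, hBC, hPAC, hRef⟩ := hsym.growsLikeMaxGain hP hJ hΓ hQ hint
      (H.tendsto_integral_log_max hU hint)
    exact ⟨hMAC.tendsto_div (hRef S hS), hBC.tendsto_div (hRef S hS),
      hPAC.tendsto_div (hRef S hS)⟩
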